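/- Let $\alpha>0$, $\beta>0$ and let $n\ge 0$ be an integer. For $t>0$ let $$w(x;t)=e^{-t/x}x^{\alpha}(1-x)^{\beta},\qquad x\in[0,1],$$ let $\mu_k(t)=\int_0^1 x^k\,w(x;t)\,dx$ for $k\ge 0$, and let $D_n(t)=\det\left(\mu_{i+j}(t)\right)_{i,j=0}^{n-1}$ (with $D_0=1$). Then the moments converge, $D_n$ is positive and differentiable on $(0,\infty)$, and the function $$H_n(t)=t\,\frac{d}{dt}\ln D_n(t)$$ is twice differentiable on $(0,\infty)$ and satisfies there $$\left(tH_n''\right)^2=\left[n(n+\alpha+\beta)-H_n+(\alpha+t)H_n'\right]^2+4H_n'\left(tH_n'-H_n\right)\left(\beta-H_n'\right).$$ Moreover, a function $H$ on $(0,\infty)$ is a twice differentiable solution of this equation (with $H$ in place of $H_n$) if and only if $\sigma=H-n(n+\alpha+\beta)$ is a twice differentiable solution of the Jimbo–Miwa–Okamoto $\sigma$-form of Painlevé V, $$\left(t\sigma''\right)^2=\left[\sigma-t\sigma'+2(\sigma')^2+(\nu_0+\nu_1+\nu_2+\nu_3)\sigma'\right]^2-4(\nu_0+\sigma')(\nu_1+\sigma')(\nu_2+\sigma')(\nu_3+\sigma'),$$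 with parameters $\nu_0=0$, $\nu_1=-(n+\alpha+\beta)$, $\nu_2=n$, $\nu_3=-\beta$. In particular, $\widetilde H_n=H_n-n(n+\alpha+\beta)$ solves this $\sigma$-form. -/

import Mathlib

noncomputable section

namespace PollaczekJacobi

/-- The weight `w(x;t) = e^{-t/x} x^α (1-x)^β` (used for `x ∈ (0,1]`). -/
def weight (α β t x : ℝ) : ℝ :=
  Real.exp (-t / x) * x ^ α * (1 - x) ^ β

/-- The moments `μ_k(t) = ∫_0^1 x^k w(x;t) dx`. -/
def moment (α β : ℝ) (k : ℕ) (t : ℝ) : ℝ :=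
  ∫ x in (0 : ℝ)..1, x ^ k * weight α β t x

/-- The Hankel determinant `D_n(t) = det (μ_{i+j}(t))_{i,j=0}^{n-1}`. -/
def hankelDet (α β : ℝ) (n : ℕ) (t : ℝ) : ℝ :=
  Matrix.det (Matrix.of fun i j : Fin n => moment α β ((i : ℕ) + (j : ℕ)) t)

/-- The logarithmic derivative `H_n(t) = t (d/dt) ln D_n(t)`. -/
def logDerivHankel (α β : ℝ) (n : ℕ) (t : ℝ) : ℝ :=
  t * deriv (fun s => Real.log (hankelDet α β n s)) t

/-- `f` is twice differentiable at every point of `(0,∞)`. -/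
def TwiceDifferentiable (f : ℝ → ℝ) : Prop :=
  ∀ t : ℝ, 0 < t → DifferentiableAt ℝ f t ∧ DifferentiableAt ℝ (deriv f) t

/-- `H` is a twice differentiable solution on `(0,∞)` of
`(t H'')² = [n(n+α+β) - H + (α+t) H']² + 4 H' (t H' - H) (β - H')`. -/
def SolvesHankelODE (α β : ℝ) (n : ℕ) (H : ℝ → ℝ) : Prop :=
  TwiceDifferentiable H ∧ ∀ t : ℝ, 0 < t →
    (t * deriv (deriv H) t) ^ 2 =
      ((n : ℝ) * ((n : ℝ) + α + β) - H t + (α + t) * deriv H t) ^ 2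
        + 4 * deriv H t * (t * deriv H t - H t) * (β - deriv H t)

/-- `σ` is a twice differentiable solution on `(0,∞)` of the Jimbo-Miwa-Okamoto σ-form of
Painlevé V with parameters `ν₀, ν₁, ν₂, ν₃`:
`(t σ'')² = [σ - t σ' + 2 (σ')² + (ν₀+ν₁+ν₂+ν₃) σ']²
  - 4 (ν₀+σ') (ν₁+σ') (ν₂+σ') (ν₃+σ')`. -/
def SolvesSigmaPV (ν₀ ν₁ ν₂ ν₃ : ℝ) (σ : ℝ → ℝ) : Prop :=
  TwiceDifferentiable σ ∧ ∀ t : ℝ, 0 < t →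
    (t * deriv (deriv σ) t) ^ 2 =
      (σ t - t * deriv σ t + 2 * deriv σ t ^ 2 + (ν₀ + ν₁ + ν₂ + ν₃) * deriv σ t) ^ 2
        - 4 * (ν₀ + deriv σ t) * (ν₁ + deriv σ t) * (ν₂ + deriv σ t) * (ν₃ + deriv σ t)

end PollaczekJacobi

end

/-! Put `y = 1/x`. Reversing rows and columns turns `D_{n+1}` into the Hankel determinant of the
moments `m_k(t) = ∫ x^(S-k) e^(-t/x) (1-x)^β dx` with `S = α + 2n`. In the variable `y` these belong
to a positive measure `e^(-ty) dν(y)`, so that `m_k' = -m_{k+1}`. The exponent `S` depends on the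
size of the determinant, but that size is fixed throughout the argument.

Let `P_k` be the monic orthogonal polynomials in `y`, `p` the subleading coefficient of `P_{n+1}`,
`b` the ratio of the squared norms of `P_{n+1}` and `P_n`, and `z`, `x` the diagonal recurrence
coefficients of index `n` and `n+1`. The exponential dependence on `t` gives the Toda equations `(ln
D_{n+1})' = p`, `p' = b`, `b' = b (z - x)` (`hasDerivAt_log_hankel`, `hasDerivAt_subCoeff_succ`,
`hasDerivAt_recOff`).

Integration by parts gives a three-term recurrence for the moments (`realMoment_recurrence`), and
from it the ladder relations expressing `y(y-1)P'` for `P = P_{n+1}, P_n` through `P_{n+1}` and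
`P_n`. At `y = 0` and `y = 1` the left sides vanish while `P_{n+1}`, `P_n` have no common zero, so
the ladder matrix is singular there (`ladder_det`). These two relations give the product and the sum
of two quantities whose difference is, up to the factor `t b`, `t H''`; the equation is then `(u-v)²
= (u+v)² - 4uv` (`sigma_form`). -/

/-! ### Monic orthogonal polynomials of a positive moment functional -/

namespace HankelOrtho

open Polynomial

/-- The linear functional on polynomials with moments `m`. -/
noncomputable def momentFunctional (m : ℕ → ℝ) : ℝ[X] →ₗ[ℝ] ℝ :=
  Polynomial.lsum fun k => m k • LinearMap.id

lemma momentFunctional_eq_sum (m : ℕ → ℝ) (q : ℝ[X]) {N : ℕ} (hN : q.natDegree < N) :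
    momentFunctional m q = ∑ i ∈ Finset.range N, q.coeff i * m i := by
  rw [momentFunctional, Polynomial.lsum_apply, Polynomial.sum_over_range' _ (by simp) N hN]
  simp [mul_comm]

@[simp] lemma momentFunctional_X_pow (m : ℕ → ℝ) (k : ℕ) :
    momentFunctional m (X ^ k) = m k := by
  rw [momentFunctional_eq_sum m (X ^ k) (N := k + 1) (by simp)]
  simp [coeff_X_pow]

lemma momentFunctional_C_mul (m : ℕ → ℝ) (c : ℝ) (q : ℝ[X]) :
    momentFunctional m (C c * q) = c * momentFunctional m q := by
  rw [← smul_eq_C_mul, map_smul, smul_eq_mul]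

/-- Monic orthogonal polynomials, defined by their three-term recurrence. -/
noncomputable def orthoPoly (m : ℕ → ℝ) : ℕ → ℝ[X]
  | 0 => 1
  | 1 => X - C (momentFunctional m (X * 1 * 1) / momentFunctional m (1 * 1))
  | n + 2 =>
    (X - C (momentFunctional m (X * orthoPoly m (n + 1) * orthoPoly m (n + 1)) /
        momentFunctional m (orthoPoly m (n + 1) * orthoPoly m (n + 1)))) * orthoPoly m (n + 1) -
      C (momentFunctional m (orthoPoly m (n + 1) * orthoPoly m (n + 1)) /
        momentFunctional m (orthoPoly m n * orthoPoly m n)) * orthoPoly m n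

/-- The squared norm of the orthogonal polynomial of degree `n`. -/
noncomputable def normSq (m : ℕ → ℝ) (n : ℕ) : ℝ :=
  momentFunctional m (orthoPoly m n * orthoPoly m n)

/-- The diagonal recurrence coefficient. -/
noncomputable def recDiag (m : ℕ → ℝ) (n : ℕ) : ℝ :=
  momentFunctional m (X * orthoPoly m n * orthoPoly m n) / normSq m n

/-- The subleading coefficient of the orthogonal polynomial of degree `n`. -/
noncomputable def subCoeff (m : ℕ → ℝ) (n : ℕ) : ℝ :=
  -∑ k ∈ Finset.range n, recDiag m k

lemma subCoeff_succ (m : ℕ → ℝ) (n : ℕ) : subCoeff m (n + 1) = subCoeff m n - recDiag m n := by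
  simp [subCoeff, Finset.sum_range_succ]; ring

lemma orthoPoly_zero (m : ℕ → ℝ) : orthoPoly m 0 = 1 := by rw [orthoPoly]

lemma orthoPoly_one (m : ℕ → ℝ) : orthoPoly m 1 = X - C (recDiag m 0) := by
  rw [orthoPoly, recDiag, normSq, orthoPoly_zero]

lemma orthoPoly_add_two (m : ℕ → ℝ) (n : ℕ) :
    orthoPoly m (n + 2) = (X - C (recDiag m (n + 1))) * orthoPoly m (n + 1) -
      C (normSq m (n + 1) / normSq m n) * orthoPoly m n := by
  rw [orthoPoly]; rfl

lemma orthoPoly_monic_natDegree (m : ℕ → ℝ) (n : ℕ) :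
    (orthoPoly m n).Monic ∧ (orthoPoly m n).natDegree = n := by
  induction n using Nat.strong_induction_on with
  | _ n ih =>
    match n with
    | 0 => simp [orthoPoly_zero]
    | 1 => rw [orthoPoly_one]; exact ⟨monic_X_sub_C _, natDegree_X_sub_C _⟩
    | n + 2 =>
      obtain ⟨m1, d1⟩ := ih (n + 1) (by omega)
      obtain ⟨m0, d0⟩ := ih n (by omega)
      have hm : ((X - C (recDiag m (n + 1))) * orthoPoly m (n + 1)).Monic :=
        (monic_X_sub_C _).mul m1
      have hd : ((X - C (recDiag m (n + 1))) * orthoPoly m (n + 1)).natDegree = n + 2 := by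
        rw [(monic_X_sub_C _).natDegree_mul m1, natDegree_X_sub_C, d1]; omega
      have hlt : (C (normSq m (n + 1) / normSq m n) * orthoPoly m n).natDegree < n + 2 :=
        lt_of_le_of_lt (natDegree_C_mul_le _ _) (by omega)
      have hdeg : (C (normSq m (n + 1) / normSq m n) * orthoPoly m n).degree <
          ((X - C (recDiag m (n + 1))) * orthoPoly m (n + 1)).degree := by
        rw [degree_eq_natDegree hm.ne_zero, hd]
        exact (degree_lt_iff_coeff_zero _ _).2 fun k hk => coeff_eq_zero_of_natDegree_lt (hlt.trans_le hk)
      rw [orthoPoly_add_two]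
      exact ⟨hm.sub_of_left hdeg, by rw [natDegree_sub_eq_left_of_natDegree_lt (by omega), hd]⟩

lemma orthoPoly_monic (m : ℕ → ℝ) (n : ℕ) : (orthoPoly m n).Monic :=
  (orthoPoly_monic_natDegree m n).1

lemma natDegree_orthoPoly (m : ℕ → ℝ) (n : ℕ) : (orthoPoly m n).natDegree = n :=
  (orthoPoly_monic_natDegree m n).2

lemma orthoPoly_coeff_self (m : ℕ → ℝ) (n : ℕ) : (orthoPoly m n).coeff n = 1 := by
  have := orthoPoly_monic m n
  rwa [Monic, leadingCoeff, natDegree_orthoPoly] at this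

lemma orthoPoly_coeff_of_lt (m : ℕ → ℝ) {n k : ℕ} (h : n < k) : (orthoPoly m n).coeff k = 0 :=
  coeff_eq_zero_of_natDegree_lt (by rwa [natDegree_orthoPoly])

lemma orthoPoly_succ_coeff (m : ℕ → ℝ) (n : ℕ) :
    (orthoPoly m (n + 1)).coeff n = subCoeff m (n + 1) := by
  induction n with
  | zero => simp [orthoPoly_one, subCoeff]
  | succ n ih =>
    rw [orthoPoly_add_two, subCoeff_succ, sub_mul]
    simp only [coeff_sub, coeff_X_mul, coeff_C_mul, ih, orthoPoly_coeff_self,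
      orthoPoly_coeff_of_lt m (Nat.lt_succ_self n)]
    ring

lemma momentFunctional_mul_eq_zero (m : ℕ → ℝ) (f : ℝ[X]) {n : ℕ}
    (h : ∀ j < n, momentFunctional m (f * X ^ j) = 0) {q : ℝ[X]} (hq : q.degree < n) :
    momentFunctional m (f * q) = 0 := by
  have hsum : q = ∑ i ∈ Finset.range n, C (q.coeff i) * X ^ i := by
    ext k
    simp only [finsetSum_coeff, coeff_C_mul, coeff_X_pow]
    by_cases hk : k < n
    · simp [hk]
    · have : q.coeff k = 0 := coeff_eq_zero_of_degree_lt
        (hq.trans_le (by exact_mod_cast not_lt.1 hk))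
      simp [hk, this]
  rw [hsum, Finset.mul_sum, map_sum]
  refine Finset.sum_eq_zero fun i hi => ?_
  rw [mul_left_comm, momentFunctional_C_mul, h i (Finset.mem_range.1 hi), mul_zero]

/-- The functional is positive definite. -/
def PosFunctional (m : ℕ → ℝ) : Prop := ∀ q : ℝ[X], q ≠ 0 → 0 < momentFunctional m (q * q)

variable {m : ℕ → ℝ}

lemma PosFunctional.normSq_pos (hm : PosFunctional m) (n : ℕ) : 0 < normSq m n :=
  hm _ (orthoPoly_monic m n).ne_zero

lemma degree_sub_orthoPoly_lt (m : ℕ → ℝ) {n : ℕ} {q : ℝ[X]} (hq : q.natDegree ≤ n) :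
    (q - C (q.coeff n) * orthoPoly m n).degree < n := by
  rw [degree_lt_iff_coeff_zero]
  intro k hk
  rcases hk.eq_or_lt with rfl | hk
  · simp [orthoPoly_coeff_self]
  · simp [orthoPoly_coeff_of_lt m hk, coeff_eq_zero_of_natDegree_lt (hq.trans_lt hk)]

lemma momentFunctional_orthoPoly_mul_of_orthogonal (m : ℕ → ℝ) {n : ℕ}
    (h : ∀ q : ℝ[X], q.degree < n → momentFunctional m (orthoPoly m n * q) = 0)
    {q : ℝ[X]} (hq : q.natDegree ≤ n) :
    momentFunctional m (orthoPoly m n * q) = q.coeff n * normSq m n := by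
  have h1 := h _ (degree_sub_orthoPoly_lt m hq)
  rw [mul_sub, map_sub, mul_left_comm, momentFunctional_C_mul] at h1
  rw [normSq]; linarith

/-- The recurrence coefficients are those that orthogonality forces: the norm ratio cancels `X *
P_{n+1}` against `P_n` in degrees at most `n`, and `recDiag` removes the component along `P_{n+1}`.
Positivity enters only to make the denominators nonzero. -/
lemma PosFunctional.orthogonal (hm : PosFunctional m) (n : ℕ) :
    ∀ q : ℝ[X], q.degree < n → momentFunctional m (orthoPoly m n * q) = 0 := by
  induction n using Nat.strong_induction_on with
  | _ n ih =>
    match n with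
    | 0 =>
      intro q hq
      have : q = 0 := by
        rw [← degree_eq_bot]
        exact Nat.WithBot.lt_zero_iff.1 (by exact_mod_cast hq)
      simp [this]
    | 1 =>
      intro q hq
      refine momentFunctional_mul_eq_zero m _ (fun j hj => ?_) hq
      obtain rfl : j = 0 := by omega
      have h0 := (hm.normSq_pos 0).ne'
      have hC : momentFunctional m (C (recDiag m 0)) =
          recDiag m 0 * momentFunctional m (1 : ℝ[X]) := by
        rw [← momentFunctional_C_mul, mul_one]
      rw [orthoPoly_one, pow_zero, mul_one, map_sub, hC, recDiag]
      simp only [normSq, orthoPoly_zero, mul_one] at h0 ⊢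
      field_simp; ring
    | n + 2 =>
      intro q hq
      have ih1 := ih (n + 1) (by omega)
      have ih0 := ih n (by omega)
      have e1 := fun q => momentFunctional_orthoPoly_mul_of_orthogonal m ih1 (q := q)
      have e0 := fun q => momentFunctional_orthoPoly_mul_of_orthogonal m ih0 (q := q)
      have h0 := (hm.normSq_pos n).ne'
      have h1 := (hm.normSq_pos (n + 1)).ne'
      have expand : ∀ f : ℝ[X], momentFunctional m (orthoPoly m (n + 2) * f) =
          momentFunctional m (orthoPoly m (n + 1) * (X * f)) -
            recDiag m (n + 1) * momentFunctional m (orthoPoly m (n + 1) * f) -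
            normSq m (n + 1) / normSq m n * momentFunctional m (orthoPoly m n * f) := by
        intro f
        rw [orthoPoly_add_two, ← momentFunctional_C_mul, ← momentFunctional_C_mul, ← map_sub,
          ← map_sub]
        congr 1; ring
      have low : ∀ f : ℝ[X], f.degree < (n + 1 : ℕ) →
          momentFunctional m (orthoPoly m (n + 2) * f) = 0 := by
        intro f hf
        have hfn : f.natDegree ≤ n := by
          rw [natDegree_le_iff_coeff_eq_zero]
          exact fun k hk => (degree_lt_iff_coeff_zero _ _).1 hf k hk
        have hXf : (X * f).natDegree ≤ n + 1 := natDegree_mul_le.trans (by simp; omega)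
        rw [expand, e1 _ hXf, ih1 f hf, e0 f hfn, coeff_X_mul]
        field_simp; ring
      have top : momentFunctional m (orthoPoly m (n + 2) * orthoPoly m (n + 1)) = 0 := by
        have hd : (orthoPoly m n).degree < (n + 1 : ℕ) := by
          rw [degree_eq_natDegree (orthoPoly_monic m n).ne_zero, natDegree_orthoPoly]
          exact_mod_cast Nat.lt_succ_self n
        rw [expand, mul_comm (orthoPoly m n), ih1 _ hd, mul_left_comm, ← mul_assoc X, recDiag,
          ← normSq]
        field_simp; ring
      have hqn : q.natDegree ≤ n + 1 := by
        rw [natDegree_le_iff_coeff_eq_zero]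
        exact fun k hk => (degree_lt_iff_coeff_zero _ _).1 hq k hk
      have := low _ (degree_sub_orthoPoly_lt m hqn)
      rw [mul_sub, map_sub, mul_left_comm, momentFunctional_C_mul, top] at this
      linarith

lemma PosFunctional.orthoPoly_mul (hm : PosFunctional m) {n : ℕ} {q : ℝ[X]}
    (hq : q.natDegree ≤ n) :
    momentFunctional m (orthoPoly m n * q) = q.coeff n * normSq m n :=
  momentFunctional_orthoPoly_mul_of_orthogonal m (hm.orthogonal n) hq

lemma PosFunctional.orthoPoly_mul_X_pow_lt (hm : PosFunctional m) {n j : ℕ} (h : j < n) :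
    momentFunctional m (orthoPoly m n * X ^ j) = 0 :=
  hm.orthogonal n _ (by rw [degree_X_pow]; exact_mod_cast h)

lemma PosFunctional.orthoPoly_mul_X_pow_self (hm : PosFunctional m) (n : ℕ) :
    momentFunctional m (orthoPoly m n * X ^ n) = normSq m n := by
  rw [hm.orthoPoly_mul (by simp)]; simp

lemma PosFunctional.orthoPoly_mul_X_pow_succ (hm : PosFunctional m) (n : ℕ) :
    momentFunctional m (orthoPoly m n * X ^ (n + 1)) = -subCoeff m (n + 1) * normSq m n := by
  have hd : (X ^ (n + 1) - orthoPoly m (n + 1)).natDegree ≤ n := by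
    rw [natDegree_le_iff_coeff_eq_zero]
    intro k hk
    rcases (Nat.succ_le_of_lt hk).eq_or_lt with rfl | hk
    · simp [orthoPoly_coeff_self]
    · simp [orthoPoly_coeff_of_lt m hk, coeff_X_pow, hk.ne']
  have h1 := hm.orthoPoly_mul hd
  have h2 : momentFunctional m (orthoPoly m (n + 1) * orthoPoly m n) = 0 :=
    hm.orthogonal _ _ (by
      rw [degree_eq_natDegree (orthoPoly_monic m n).ne_zero, natDegree_orthoPoly]
      exact_mod_cast Nat.lt_succ_self n)
  rw [mul_sub, map_sub, mul_comm _ (orthoPoly m (n + 1)), h2, coeff_sub, orthoPoly_succ_coeff,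
    coeff_X_pow] at h1
  simpa using h1

lemma PosFunctional.eq_zero_of_orthogonal (hm : PosFunctional m) {n : ℕ} {q : ℝ[X]}
    (hq : q.degree < n) (h : ∀ j < n, momentFunctional m (q * X ^ j) = 0) : q = 0 := by
  by_contra hne
  exact (hm q hne).ne' (momentFunctional_mul_eq_zero m q h hq)

/-- A common zero of two neighbours would descend through the recurrence, whose norm ratios are
nonzero, to `P_0 = 1`. -/
lemma PosFunctional.eval_ne_zero (y : ℝ) (hm : PosFunctional m) (n : ℕ) :
    (orthoPoly m (n + 1)).eval y ≠ 0 ∨ (orthoPoly m n).eval y ≠ 0 := by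
  induction n with
  | zero => right; simp [orthoPoly_zero]
  | succ n ih =>
    by_contra! hc
    obtain ⟨h2, h1⟩ := hc
    rw [orthoPoly_add_two] at h2
    simp only [eval_sub, eval_mul, h1, mul_zero, zero_sub, eval_C, neg_eq_zero, mul_eq_zero] at h2
    have := div_pos (hm.normSq_pos (n + 1)) (hm.normSq_pos n)
    rcases ih with h | h
    · exact h h1
    · rcases h2 with h2 | h2
      · exact this.ne' h2
      · exact h h2

/-- The unitriangular matrix `T` of coefficients of the `P_i` turns the Gram matrix into `⟨P_i,
X^j⟩`, which is upper triangular with the squared norms on its diagonal. -/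
lemma hankel_det_eq_prod (hm : PosFunctional m) (n : ℕ) :
    (Matrix.of fun i j : Fin n => m ((i : ℕ) + (j : ℕ))).det =
      ∏ k ∈ Finset.range n, normSq m k := by
  set G : Matrix (Fin n) (Fin n) ℝ := Matrix.of fun i j : Fin n => m ((i : ℕ) + (j : ℕ))
  set T : Matrix (Fin n) (Fin n) ℝ := Matrix.of fun i j : Fin n => (orthoPoly m i).coeff j
  have hT : T.det = 1 := by
    rw [Matrix.det_of_isLowerTriangular T (fun i j hij => orthoPoly_coeff_of_lt m hij)]
    simp [T, orthoPoly_coeff_self]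
  have hTG : ∀ i j : Fin n, (T * G) i j = momentFunctional m (orthoPoly m i * X ^ (j : ℕ)) := by
    intro i j
    have hsum : orthoPoly m i = ∑ k ∈ Finset.range n, C ((orthoPoly m i).coeff k) * X ^ k := by
      conv_lhs => rw [as_sum_range_C_mul_X_pow' (orthoPoly m i) (n := n)
        (by rw [natDegree_orthoPoly]; exact i.2)]
    conv_rhs => rw [hsum, Finset.sum_mul, map_sum, Finset.sum_range]
    rw [Matrix.mul_apply]
    refine Finset.sum_congr rfl fun k _ => ?_
    rw [mul_assoc, momentFunctional_C_mul, ← pow_add, momentFunctional_X_pow]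
    rfl
  have h := Matrix.det_of_isUpperTriangular (M := T * G) (fun i j hij => by
    rw [hTG]; exact hm.orthoPoly_mul_X_pow_lt hij)
  rw [Matrix.det_mul, hT, one_mul] at h
  rw [h, Finset.prod_range]
  exact Finset.prod_congr rfl fun k _ => by rw [hTG, hm.orthoPoly_mul_X_pow_self]

end HankelOrtho

/-! ### Ladder relations from the Pearson recurrence -/

namespace HankelOrtho

open Polynomial

variable {m : ℕ → ℝ}

lemma coeff_X_mul_derivative (f : ℝ[X]) (k : ℕ) :
    (X * derivative f).coeff k = k * f.coeff k := by
  cases k with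
  | zero => simp
  | succ k => rw [coeff_X_mul, coeff_derivative]; push_cast; ring

lemma X_mul_derivative_X_pow (k : ℕ) :
    X * derivative (X ^ k : ℝ[X]) = C (k : ℝ) * X ^ k := by
  ext i
  rw [coeff_X_mul_derivative, coeff_C_mul, coeff_X_pow]
  split_ifs with hi <;> simp [hi]

lemma coeff_succ_X_mul_X_sub_one_mul_derivative (f : ℝ[X]) (k : ℕ) :
    (X * (X - 1) * derivative f).coeff (k + 1) = k * f.coeff k - (k + 1) * f.coeff (k + 1) := by
  have : X * (X - 1) * derivative f = X * (X * derivative f) - X * derivative f := by ring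
  rw [this, coeff_sub, coeff_X_mul, coeff_X_mul_derivative, coeff_X_mul_derivative]
  push_cast; ring

lemma coeff_X_mul_orthoPoly_self (m : ℕ → ℝ) (n : ℕ) :
    (X * orthoPoly m n).coeff n = subCoeff m n := by
  cases n with
  | zero => simp [subCoeff]
  | succ n => rw [coeff_X_mul, orthoPoly_succ_coeff]

/-- The recurrence of the moments of a weight with `((y² - y) w)' = -(t y² + (S - t) y - S - β - 1) w`. -/
def PearsonMoments (t S β : ℝ) (m : ℕ → ℝ) : Prop :=
  ∀ k : ℕ, t * m (k + 2) = (t - S + k) * m (k + 1) + (S - k + β + 1) * m k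

/-- Integration by parts in algebraic form: on the monomial `X^k` it is the moment recurrence of
index `k`. -/
lemma PearsonMoments.derivative {t S β : ℝ} (h : PearsonMoments t S β m) (q : ℝ[X]) :
    momentFunctional m (X * (X - 1) * derivative q) =
      momentFunctional m ((C t * X ^ 2 + C (S - t) * X - C (S + β + 1)) * q) := by
  induction q using Polynomial.induction_on' with
  | add p q hp hq => rw [derivative_add, mul_add, mul_add, map_add, map_add, hp, hq]
  | monomial k c =>
    have hX : X * Polynomial.derivative (X ^ k : ℝ[X]) = C (k : ℝ) * X ^ k :=
      X_mul_derivative_X_pow k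
    have e1 : X * (X - 1) * Polynomial.derivative (C c * X ^ k) =
        C c * (C (k : ℝ) * X ^ (k + 1) - C (k : ℝ) * X ^ k) := by
      rw [derivative_C_mul]
      linear_combination (C c * (X - 1)) * hX
    have e2 : (C t * X ^ 2 + C (S - t) * X - C (S + β + 1)) * (C c * X ^ k) =
        C c * (C t * X ^ (k + 2) + C (S - t) * X ^ (k + 1) - C (S + β + 1) * X ^ k) := by ring
    rw [← C_mul_X_pow_eq_monomial, e1, e2]
    simp only [momentFunctional_C_mul, LinearMap.map_sub, LinearMap.map_add, momentFunctional_X_pow] at *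
    linear_combination (-c) * h k

lemma PearsonMoments.derivative_mul_X_pow {t S β : ℝ} (h : PearsonMoments t S β m) (f : ℝ[X])
    (j : ℕ) :
    momentFunctional m (X * (X - 1) * Polynomial.derivative f * X ^ j) =
      t * momentFunctional m (f * X ^ (j + 2)) + (S - t - j) * momentFunctional m (f * X ^ (j + 1)) +
        (j - S - β - 1) * momentFunctional m (f * X ^ j) := by
  have hX : X * Polynomial.derivative (X ^ j : ℝ[X]) = C (j : ℝ) * X ^ j :=
    X_mul_derivative_X_pow j
  have h1 := h.derivative (f * X ^ j)
  have e1 : X * (X - 1) * Polynomial.derivative (f * X ^ j) =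
      X * (X - 1) * Polynomial.derivative f * X ^ j +
        (C (j : ℝ) * (f * X ^ (j + 1)) - C (j : ℝ) * (f * X ^ j)) := by
    rw [derivative_mul]
    linear_combination (f * (X - 1)) * hX
  have e2 : (C t * X ^ 2 + C (S - t) * X - C (S + β + 1)) * (f * X ^ j) =
      C t * (f * X ^ (j + 2)) + C (S - t) * (f * X ^ (j + 1)) - C (S + β + 1) * (f * X ^ j) := by
    ring
  rw [e1, e2] at h1
  simp only [momentFunctional_C_mul, LinearMap.map_sub, LinearMap.map_add] at h1
  linarith

/-- The off-diagonal recurrence coefficient of index `n + 1`. -/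
noncomputable def recOff (m : ℕ → ℝ) (n : ℕ) : ℝ := normSq m (n + 1) / normSq m n

lemma PosFunctional.recOff_mul (hm : PosFunctional m) (n : ℕ) :
    recOff m n * normSq m n = normSq m (n + 1) :=
  div_mul_cancel₀ _ (hm.normSq_pos n).ne'

/-- The difference of the two sides has degree below `n+1` and is orthogonal to every `X^j` with `j
< n+1`, so positivity kills it. The coefficients come from matching the two top degrees and the
pairings with `X^n` and `X^(n-1)`. -/
lemma ladder_lowering (hm : PosFunctional m) {t α β : ℝ} {n : ℕ}
    (h : PearsonMoments t (α + 2 * n) β m) :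
    X * (X - 1) * derivative (orthoPoly m (n + 1)) =
      (C (n + 1 : ℝ) * X + C (-(n + 1) - subCoeff m (n + 1) - t * recOff m n)) * orthoPoly m (n + 1)
      + (C (recOff m n * t) * X + C (recOff m n * (t * recDiag m (n + 1) - t + α - 1))) *
        orthoPoly m n := by
  rw [← sub_eq_zero]
  refine hm.eq_zero_of_orthogonal (n := n + 1) ?_ fun j hj => ?_
  · rw [degree_lt_iff_coeff_zero]
    intro k hk
    obtain ⟨k, rfl⟩ : ∃ i, k = i + 1 := ⟨k - 1, by omega⟩
    rw [coeff_sub, coeff_succ_X_mul_X_sub_one_mul_derivative]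
    simp only [coeff_add, add_mul, mul_assoc, coeff_C_mul, coeff_X_mul]
    rcases (show n ≤ k by omega).eq_or_lt with rfl | hk1
    · simp only [orthoPoly_succ_coeff, orthoPoly_coeff_self,
        orthoPoly_coeff_of_lt m (Nat.lt_succ_self n)]
      ring
    · rw [orthoPoly_coeff_of_lt m hk1, orthoPoly_coeff_of_lt m (hk1.trans (Nat.lt_succ_self k)),
        orthoPoly_coeff_of_lt m (Nat.succ_lt_succ hk1)]
      rcases (Nat.succ_le_of_lt hk1).eq_or_lt with rfl | hk2
      · simp only [orthoPoly_coeff_self]; push_cast; ring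
      · rw [orthoPoly_coeff_of_lt m hk2]; ring
  · have e : ∀ (D P Q : ℝ[X]) (a b c d : ℝ),
        (D - ((C a * X + C b) * P + (C c * X + C d) * Q)) * X ^ j =
          D * X ^ j - (C a * (P * X ^ (j + 1)) + C b * (P * X ^ j) +
            (C c * (Q * X ^ (j + 1)) + C d * (Q * X ^ j))) := by intros; ring
    rw [e]
    simp only [LinearMap.map_sub, LinearMap.map_add, momentFunctional_C_mul, h.derivative_mul_X_pow]
    rw [hm.orthoPoly_mul_X_pow_lt hj]
    have hb := hm.recOff_mul n
    -- The pairing with `X^j` involves no power beyond `X^(j+2)`, so it vanishes term by term unless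
    -- `j = n` or `j = n-1`.
    rcases (show j ≤ n by omega).eq_or_lt with rfl | hj1
    · rw [hm.orthoPoly_mul_X_pow_succ (j + 1), hm.orthoPoly_mul_X_pow_self (j + 1),
        hm.orthoPoly_mul_X_pow_succ j, hm.orthoPoly_mul_X_pow_self j, ← hb,
        subCoeff_succ m (j + 1)]
      ring
    · rw [hm.orthoPoly_mul_X_pow_lt (Nat.succ_lt_succ hj1), hm.orthoPoly_mul_X_pow_lt hj1]
      rcases (Nat.succ_le_of_lt hj1).eq_or_lt with rfl | hj2
      · rw [hm.orthoPoly_mul_X_pow_self (j + 1 + 1), hm.orthoPoly_mul_X_pow_self (j + 1), ← hb]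
        ring
      · rw [hm.orthoPoly_mul_X_pow_lt (Nat.succ_lt_succ hj2), hm.orthoPoly_mul_X_pow_lt hj2]
        ring

/-- Same mechanism as `ladder_lowering`. The quadratic coefficient of `P_n` absorbs the `t X^2` term
that integration by parts produces. -/
lemma ladder_raising (hm : PosFunctional m) {t α β : ℝ} {n : ℕ}
    (h : PearsonMoments t (α + 2 * n) β m) :
    X * (X - 1) * derivative (orthoPoly m n) =
      (C (-t) * X + C (-(t * recDiag m n - t + α + 1))) * orthoPoly m (n + 1)
      + (C t * X ^ 2 + C (α + (n + 1) - t) * X +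
          C (-(α + β + (n + 1)) + subCoeff m (n + 1) + t * recOff m n)) * orthoPoly m n := by
  rw [← sub_eq_zero]
  refine hm.eq_zero_of_orthogonal (n := n + 1) ?_ fun j hj => ?_
  · rw [degree_lt_iff_coeff_zero]
    intro k hk
    obtain ⟨k, rfl⟩ : ∃ i, k = i + 1 := ⟨k - 1, by omega⟩
    rw [coeff_sub, coeff_succ_X_mul_X_sub_one_mul_derivative]
    simp only [coeff_add, add_mul, mul_assoc, coeff_C_mul, coeff_X_mul, pow_two]
    rcases (show n ≤ k by omega).eq_or_lt with rfl | hk1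
    · simp only [orthoPoly_succ_coeff, orthoPoly_coeff_self, coeff_X_mul_orthoPoly_self,
        orthoPoly_coeff_of_lt m (Nat.lt_succ_self n), subCoeff_succ]
      ring
    · obtain ⟨k, rfl⟩ : ∃ i, k = i + 1 := ⟨k - 1, by omega⟩
      rw [coeff_X_mul, orthoPoly_coeff_of_lt m hk1,
        orthoPoly_coeff_of_lt m (hk1.trans (Nat.lt_succ_self _)),
        orthoPoly_coeff_of_lt m (Nat.succ_lt_succ hk1)]
      rcases (Nat.le_of_lt_succ hk1).eq_or_lt with rfl | hk2
      · simp only [orthoPoly_coeff_self]; ring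
      · rw [orthoPoly_coeff_of_lt m hk2, orthoPoly_coeff_of_lt m (Nat.succ_lt_succ hk2)]; ring
  · have e : ∀ (D P Q : ℝ[X]) (a b c d e : ℝ),
        (D - ((C a * X + C b) * P + (C c * X ^ 2 + C d * X + C e) * Q)) * X ^ j =
          D * X ^ j - (C a * (P * X ^ (j + 1)) + C b * (P * X ^ j) +
            (C c * (Q * X ^ (j + 2)) + C d * (Q * X ^ (j + 1)) + C e * (Q * X ^ j))) := by
      intros; ring
    rw [e]
    simp only [LinearMap.map_sub, LinearMap.map_add, momentFunctional_C_mul, h.derivative_mul_X_pow]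
    rw [hm.orthoPoly_mul_X_pow_lt hj]
    have hb := hm.recOff_mul n
    rcases (show j ≤ n by omega).eq_or_lt with rfl | hj1
    · rw [hm.orthoPoly_mul_X_pow_self (j + 1), hm.orthoPoly_mul_X_pow_succ j,
        hm.orthoPoly_mul_X_pow_self j, ← hb]
      ring
    · rw [hm.orthoPoly_mul_X_pow_lt (Nat.succ_lt_succ hj1), hm.orthoPoly_mul_X_pow_lt hj1]
      rcases (Nat.succ_le_of_lt hj1).eq_or_lt with rfl | hj2
      · rw [hm.orthoPoly_mul_X_pow_self (j + 1)]
        push_cast; ring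
      · rw [hm.orthoPoly_mul_X_pow_lt hj2]
        ring

lemma mul_sub_mul_eq_zero_of_kernel {a b c d x y : ℝ} (h1 : a * x + b * y = 0)
    (h2 : c * x + d * y = 0) (h : x ≠ 0 ∨ y ≠ 0) : a * d - b * c = 0 := by
  have hx : (a * d - b * c) * x = 0 := by linear_combination d * h1 - b * h2
  have hy : (a * d - b * c) * y = 0 := by linear_combination a * h2 - c * h1
  rcases h with h | h
  · exact (mul_eq_zero.1 hx).resolve_right h
  · exact (mul_eq_zero.1 hy).resolve_right h

/-- The ladder matrix is singular at the zeros `0` and `1` of `y² - y`. -/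
lemma ladder_det (hm : PosFunctional m) {t α β : ℝ} {n : ℕ}
    (h : PearsonMoments t (α + 2 * n) β m) {y : ℝ} (hy : y * (y - 1) = 0) :
    ((n + 1) * y - (n + 1) - subCoeff m (n + 1) - t * recOff m n) *
        (t * y ^ 2 + (α + (n + 1) - t) * y - (α + β + (n + 1)) + subCoeff m (n + 1)
          + t * recOff m n) +
      recOff m n * (t * y + t * recDiag m (n + 1) - t + α - 1) *
        (t * y + t * recDiag m n - t + α + 1) = 0 := by
  -- Where `y(y-1) = 0`, both ladder relations say that the matrix annihilates the nonzero vector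
  -- `(P_{n+1}(y), P_n(y))`.
  have h1 := congrArg (eval y) (ladder_lowering hm h)
  have h2 := congrArg (eval y) (ladder_raising hm h)
  simp only [eval_mul, eval_add, eval_sub, eval_X, eval_C, eval_one, eval_pow, hy, zero_mul]
    at h1 h2
  linear_combination mul_sub_mul_eq_zero_of_kernel h1.symm h2.symm (hm.eval_ne_zero y n)

end HankelOrtho

/-! ### Toda evolution in `t` and the second-order equation -/

namespace HankelOrtho

open Polynomial Filter Topology

/-- The moments of a weight of the form `e^{-ty} dν(y)`, as functions of `t > 0`. -/
structure ExpMoments (m : ℝ → ℕ → ℝ) : Prop where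
  pos : ∀ t, 0 < t → PosFunctional (m t)
  hasDerivAt : ∀ t, 0 < t → ∀ k, HasDerivAt (fun s => m s k) (-m t (k + 1)) t

variable {m : ℝ → ℕ → ℝ}

lemma ExpMoments.hasDerivAt_momentFunctional (hm : ExpMoments m) {t : ℝ} (ht : 0 < t)
    {f : ℝ → ℝ[X]} {f' : ℝ[X]} {N : ℕ} (hN : ∀ s, (f s).natDegree ≤ N) (hN' : f'.natDegree ≤ N)
    (hf : ∀ i, HasDerivAt (fun s => (f s).coeff i) (f'.coeff i) t) :
    HasDerivAt (fun s => momentFunctional (m s) (f s))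
      (momentFunctional (m t) f' - momentFunctional (m t) (X * f t)) t := by
  have e : (fun s => momentFunctional (m s) (f s)) =
      fun s => ∑ i ∈ Finset.range (N + 1), (f s).coeff i * m s i :=
    funext fun s => momentFunctional_eq_sum _ _ (Nat.lt_succ_of_le (hN s))
  have hX : (X * f t).natDegree < N + 2 := by
    have := natDegree_mul_le (p := X) (q := f t)
    have := hN t
    simp only [natDegree_X] at *
    omega
  rw [e, momentFunctional_eq_sum _ _ (Nat.lt_succ_of_le hN'), momentFunctional_eq_sum _ _ hX,
    Finset.sum_range_succ' _ (N + 1)]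
  simp only [coeff_X_mul, mul_coeff_zero, coeff_X_zero, zero_mul, add_zero]
  rw [← Finset.sum_sub_distrib]
  refine HasDerivAt.fun_sum fun i _ => ?_
  exact ((hf i).mul (hm.hasDerivAt t ht i)).congr_deriv (by ring)

lemma ExpMoments.differentiableAt_momentFunctional (hm : ExpMoments m) {t : ℝ} (ht : 0 < t)
    {f : ℝ → ℝ[X]} {N : ℕ} (hN : ∀ s, (f s).natDegree ≤ N)
    (hf : ∀ i, DifferentiableAt ℝ (fun s => (f s).coeff i) t) :
    DifferentiableAt ℝ (fun s => momentFunctional (m s) (f s)) t := by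
  have e : (fun s => momentFunctional (m s) (f s)) =
      fun s => ∑ i ∈ Finset.range (N + 1), (f s).coeff i * m s i :=
    funext fun s => momentFunctional_eq_sum _ _ (Nat.lt_succ_of_le (hN s))
  rw [e]
  exact DifferentiableAt.fun_sum fun i _ => (hf i).mul (hm.hasDerivAt t ht i).differentiableAt

lemma differentiableAt_coeff_mul {f g : ℝ → ℝ[X]} {t : ℝ}
    (hf : ∀ i, DifferentiableAt ℝ (fun s => (f s).coeff i) t)
    (hg : ∀ i, DifferentiableAt ℝ (fun s => (g s).coeff i) t) (i : ℕ) :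
    DifferentiableAt ℝ (fun s => (f s * g s).coeff i) t := by
  simp only [coeff_mul]
  exact DifferentiableAt.fun_sum fun p _ => (hf p.1).mul (hg p.2)

lemma ExpMoments.differentiableAt_normSq_of_coeff (hm : ExpMoments m) {t : ℝ} (ht : 0 < t) {n : ℕ}
    (h : ∀ i, DifferentiableAt ℝ (fun s => (orthoPoly (m s) n).coeff i) t) :
    DifferentiableAt ℝ (fun s => normSq (m s) n) t :=
  hm.differentiableAt_momentFunctional ht (N := n + n)
    (fun s => natDegree_mul_le.trans (by simp [natDegree_orthoPoly]))
    (differentiableAt_coeff_mul h h)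

lemma ExpMoments.differentiableAt_recDiag_of_coeff (hm : ExpMoments m) {t : ℝ} (ht : 0 < t) {n : ℕ}
    (h : ∀ i, DifferentiableAt ℝ (fun s => (orthoPoly (m s) n).coeff i) t) :
    DifferentiableAt ℝ (fun s => recDiag (m s) n) t := by
  refine (hm.differentiableAt_momentFunctional ht (N := 1 + n + n) (fun s => ?_)
    (differentiableAt_coeff_mul (differentiableAt_coeff_mul (fun i => ?_) h) h)).div
    (hm.differentiableAt_normSq_of_coeff ht h) ((hm.pos t ht).normSq_pos n).ne'
  · refine natDegree_mul_le.trans (add_le_add (natDegree_mul_le.trans ?_) ?_) <;>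
      simp [natDegree_orthoPoly]
  · exact differentiableAt_const _

lemma ExpMoments.differentiableAt_coeff (hm : ExpMoments m) {t : ℝ} (ht : 0 < t) (n : ℕ) :
    ∀ i, DifferentiableAt ℝ (fun s => (orthoPoly (m s) n).coeff i) t := by
  induction n using Nat.strong_induction_on with
  | _ n ih =>
    match n with
    | 0 => intro i; simp only [orthoPoly_zero]; exact differentiableAt_const _
    | 1 =>
      intro i
      simp only [orthoPoly_one, coeff_sub, coeff_C]
      refine (differentiableAt_const _).sub ?_
      split_ifs
      · exact hm.differentiableAt_recDiag_of_coeff ht (ih 0 (by omega))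
      · exact differentiableAt_const _
    | n + 2 =>
      intro i
      have h1 := ih (n + 1) (by omega)
      have h0 := ih n (by omega)
      simp only [orthoPoly_add_two, sub_mul, coeff_sub, coeff_C_mul]
      refine ((differentiableAt_coeff_mul (fun i => differentiableAt_const _) h1 i).sub
        ((hm.differentiableAt_recDiag_of_coeff ht h1).mul (h1 i))).sub
        (((hm.differentiableAt_normSq_of_coeff ht h1).div
          (hm.differentiableAt_normSq_of_coeff ht h0) ((hm.pos t ht).normSq_pos n).ne').mul (h0 i))

/-- Monicity fixes the top coefficient, so the `t`-derivative of `P_n` has degree below `n` and is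
therefore orthogonal to `P_n`. -/
lemma ExpMoments.exists_hasDerivAt_coeff (hm : ExpMoments m) {t : ℝ} (ht : 0 < t) (n : ℕ) :
    ∃ f' : ℝ[X], f'.degree < n ∧
      ∀ i, HasDerivAt (fun s => (orthoPoly (m s) n).coeff i) (f'.coeff i) t := by
  refine ⟨∑ i ∈ Finset.range n, C (deriv (fun s => (orthoPoly (m s) n).coeff i) t) * X ^ i,
    ?_, fun i => ?_⟩
  · rw [degree_lt_iff_coeff_zero]
    intro k hk
    simp only [finsetSum_coeff, coeff_C_mul, coeff_X_pow]
    exact Finset.sum_eq_zero fun i hi => by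
      rw [if_neg (by have := Finset.mem_range.1 hi; omega), mul_zero]
  · simp only [finsetSum_coeff, coeff_C_mul, coeff_X_pow]
    rcases lt_or_ge i n with hi | hi
    · simpa [hi] using (hm.differentiableAt_coeff ht n i).hasDerivAt
    · rw [Finset.sum_eq_zero fun k hk => by
        rw [if_neg (by have := Finset.mem_range.1 hk; omega), mul_zero]]
      have : (fun s => (orthoPoly (m s) n).coeff i) = fun _ => if i = n then 1 else 0 := by
        funext s
        split_ifs with h
        · rw [h, orthoPoly_coeff_self]
        · exact orthoPoly_coeff_of_lt _ (by omega)
      rw [this]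
      exact hasDerivAt_const _ _

lemma degree_orthoPoly_lt_succ (m : ℕ → ℝ) (n : ℕ) : (orthoPoly m n).degree < (n + 1 : ℕ) :=
  (degree_lt_iff_coeff_zero _ _).2 fun _ hk => orthoPoly_coeff_of_lt m hk

lemma ExpMoments.hasDerivAt_orthoPoly_mul (hm : ExpMoments m) {t : ℝ} (ht : 0 < t) {n : ℕ}
    {f' : ℝ[X]} (hdeg : f'.degree < n)
    (hf' : ∀ i, HasDerivAt (fun s => (orthoPoly (m s) n).coeff i) (f'.coeff i) t) (q : ℝ[X]) :
    HasDerivAt (fun s => momentFunctional (m s) (orthoPoly (m s) n * q))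
      (momentFunctional (m t) (f' * q) -
        momentFunctional (m t) (X * (orthoPoly (m t) n * q))) t := by
  refine hm.hasDerivAt_momentFunctional ht (N := n + q.natDegree)
    (fun s => natDegree_mul_le.trans (by rw [natDegree_orthoPoly]))
    (natDegree_mul_le.trans (by gcongr; exact natDegree_le_of_degree_le hdeg.le)) fun i => ?_
  simp only [coeff_mul]
  exact HasDerivAt.fun_sum fun p _ => (hf' p.1).mul_const _

lemma ExpMoments.hasDerivAt_normSq (hm : ExpMoments m) {t : ℝ} (ht : 0 < t) (n : ℕ) :
    HasDerivAt (fun s => normSq (m s) n) (-recDiag (m t) n * normSq (m t) n) t := by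
  obtain ⟨f', hdeg, hf'⟩ := hm.exists_hasDerivAt_coeff ht n
  -- The second factor is frozen at time `t`. Being monic of degree `n`, it still pairs with `P_n`
  -- at time `s` to give the squared norm at time `s`.
  have h := hm.hasDerivAt_orthoPoly_mul ht hdeg hf' (orthoPoly (m t) n)
  have hz := (hm.pos t ht).orthogonal n f' hdeg
  have hn := ((hm.pos t ht).normSq_pos n).ne'
  rw [mul_comm, hz, zero_sub, ← mul_assoc] at h
  have hv : -recDiag (m t) n * normSq (m t) n =
      -momentFunctional (m t) (X * orthoPoly (m t) n * orthoPoly (m t) n) := by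
    rw [recDiag]; field_simp
  rw [hv]
  refine h.congr_of_eventuallyEq ?_
  filter_upwards [lt_mem_nhds ht] with s hs
  rw [(hm.pos s hs).orthoPoly_mul (natDegree_orthoPoly _ _).le, orthoPoly_coeff_self, one_mul]

lemma ExpMoments.hasDerivAt_subCoeff_succ (hm : ExpMoments m) {t : ℝ} (ht : 0 < t) (n : ℕ) :
    HasDerivAt (fun s => subCoeff (m s) (n + 1)) (recOff (m t) n) t := by
  obtain ⟨f', hdeg, hf'⟩ := hm.exists_hasDerivAt_coeff ht (n + 1)
  -- With `P_n` frozen at time `t`, the pairing with `P_{n+1}` at time `s` vanishes for all `s` near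
  -- `t`; differentiating this identity determines the leading coefficient of `f'`.
  have h := hm.hasDerivAt_orthoPoly_mul ht hdeg hf' (orthoPoly (m t) n)
  have hzero : (fun s => momentFunctional (m s) (orthoPoly (m s) (n + 1) * orthoPoly (m t) n))
      =ᶠ[𝓝 t] fun _ => 0 := by
    filter_upwards [lt_mem_nhds ht] with s hs
    exact (hm.pos s hs).orthogonal _ _ (degree_orthoPoly_lt_succ _ _)
  have h0 := h.unique ((hasDerivAt_const t (0 : ℝ)).congr_of_eventuallyEq hzero)
  have hp := hm.pos t ht
  have hf : f'.natDegree ≤ n := by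
    rw [natDegree_le_iff_coeff_eq_zero]
    exact fun k hk => (degree_lt_iff_coeff_zero _ _).1 hdeg k hk
  have hX : (X * orthoPoly (m t) n).natDegree ≤ n + 1 :=
    natDegree_mul_le.trans (by simp [natDegree_orthoPoly, add_comm])
  rw [mul_comm f', hp.orthoPoly_mul hf, mul_left_comm, hp.orthoPoly_mul hX, coeff_X_mul,
    orthoPoly_coeff_self, one_mul, sub_eq_zero] at h0
  have hv : recOff (m t) n = f'.coeff n := by
    rw [recOff, ← h0, mul_div_cancel_right₀ _ (hp.normSq_pos n).ne']
  rw [hv]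
  simpa only [orthoPoly_succ_coeff] using hf' n

lemma ExpMoments.hasDerivAt_recOff (hm : ExpMoments m) {t : ℝ} (ht : 0 < t) (n : ℕ) :
    HasDerivAt (fun s => recOff (m s) n)
      (recOff (m t) n * (recDiag (m t) n - recDiag (m t) (n + 1))) t := by
  have h0 := ((hm.pos t ht).normSq_pos n).ne'
  refine ((hm.hasDerivAt_normSq ht (n + 1)).div (hm.hasDerivAt_normSq ht n) h0).congr_deriv ?_
  rw [recOff]
  field_simp
  ring

lemma ExpMoments.hankel_pos (hm : ExpMoments m) {t : ℝ} (ht : 0 < t) (n : ℕ) :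
    0 < (Matrix.of fun i j : Fin n => m t ((i : ℕ) + (j : ℕ))).det := by
  rw [hankel_det_eq_prod (hm.pos t ht)]
  exact Finset.prod_pos fun k _ => (hm.pos t ht).normSq_pos k

lemma ExpMoments.hasDerivAt_log_hankel (hm : ExpMoments m) {t : ℝ} (ht : 0 < t) (n : ℕ) :
    HasDerivAt (fun s => Real.log (Matrix.of fun i j : Fin n => m s ((i : ℕ) + (j : ℕ))).det)
      (subCoeff (m t) n) t := by
  have e : (fun s => Real.log (Matrix.of fun i j : Fin n => m s ((i : ℕ) + (j : ℕ))).det)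
      =ᶠ[𝓝 t] fun s => ∑ k ∈ Finset.range n, Real.log (normSq (m s) k) := by
    filter_upwards [lt_mem_nhds ht] with s hs
    rw [hankel_det_eq_prod (hm.pos s hs),
      Real.log_prod fun k _ => ((hm.pos s hs).normSq_pos k).ne']
  refine HasDerivAt.congr_of_eventuallyEq ?_ e
  rw [subCoeff, ← Finset.sum_neg_distrib]
  refine HasDerivAt.fun_sum fun k _ => ?_
  have h0 := ((hm.pos t ht).normSq_pos k).ne'
  exact ((hm.hasDerivAt_normSq ht k).log h0).congr_deriv (by field_simp)

lemma ExpMoments.differentiableAt_hankel (hm : ExpMoments m) {t : ℝ} (ht : 0 < t) (n : ℕ) :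
    DifferentiableAt ℝ (fun s => (Matrix.of fun i j : Fin n => m s ((i : ℕ) + (j : ℕ))).det) t := by
  have e : (fun s => (Matrix.of fun i j : Fin n => m s ((i : ℕ) + (j : ℕ))).det)
      =ᶠ[𝓝 t] fun s => ∏ k ∈ Finset.range n, normSq (m s) k := by
    filter_upwards [lt_mem_nhds ht] with s hs
    exact hankel_det_eq_prod (hm.pos s hs) n
  refine DifferentiableAt.congr_of_eventuallyEq ?_ e
  exact DifferentiableAt.fun_finsetProd fun k _ => (hm.hasDerivAt_normSq ht k).differentiableAt

/-- First and second derivative of `t ↦ t p(t)`, with `p` the logarithmic derivative of the Hankel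
determinant, together with the resulting second order equation. -/
lemma ExpMoments.sigma_form (hm : ExpMoments m) {α β : ℝ} {n : ℕ}
    (hP : ∀ t, 0 < t → PearsonMoments t (α + 2 * n) β (m t)) {H : ℝ → ℝ}
    (hH : ∀ t, 0 < t → H t = t * subCoeff (m t) (n + 1)) {t : ℝ} (ht : 0 < t) :
    DifferentiableAt ℝ H t ∧ DifferentiableAt ℝ (deriv H) t ∧
      (t * deriv (deriv H) t) ^ 2 =
        ((n + 1 : ℝ) * ((n + 1 : ℝ) + α + β) - H t + (α + t) * deriv H t) ^ 2
          + 4 * deriv H t * (t * deriv H t - H t) * (β - deriv H t) := by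
  have d1 : ∀ s, 0 < s → HasDerivAt H (subCoeff (m s) (n + 1) + s * recOff (m s) n) s := by
    intro s hs
    have h := (hasDerivAt_id s).mul (hm.hasDerivAt_subCoeff_succ hs n)
    simp only [id, one_mul] at h
    refine h.congr_of_eventuallyEq ?_
    filter_upwards [lt_mem_nhds hs] with u hu
    exact hH u hu
  have d2 : HasDerivAt (deriv H) (recOff (m t) n + (recOff (m t) n +
      t * (recOff (m t) n * (recDiag (m t) n - recDiag (m t) (n + 1))))) t := by
    have h := (hm.hasDerivAt_subCoeff_succ ht n).add
      ((hasDerivAt_id t).mul (hm.hasDerivAt_recOff ht n))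
    simp only [id, one_mul] at h
    refine h.congr_of_eventuallyEq ?_
    filter_upwards [lt_mem_nhds ht] with u hu
    exact (d1 u hu).deriv
  refine ⟨(d1 t ht).differentiableAt, d2.differentiableAt, ?_⟩
  rw [d2.deriv, (d1 t ht).deriv, hH t ht]
  -- With `u = t z + α + 1` and `v = t x + α - 1`, `y = 1` gives `b u v`, and its difference with `y
  -- = 0` gives `t b (u + v)`. Here `H' = p + t b` and `t H' - H = t² b`.
  have e0 := ladder_det (hm.pos t ht) (hP t ht) (y := 0) (by ring)
  have e1 := ladder_det (hm.pos t ht) (hP t ht) (y := 1) (by ring)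
  set p := subCoeff (m t) (n + 1)
  set b := recOff (m t) n
  set x := recDiag (m t) (n + 1)
  set z := recDiag (m t) n
  have hprod : b * (t * x + α - 1) * (t * z + α + 1) = (p + t * b) * (p + t * b - β) := by
    linear_combination e1
  have hsum : t * b * ((t * x + α - 1) + (t * z + α + 1)) =
      α * (p + t * b) + (n + 1) * (n + 1 + α + β) + t ^ 2 * b := by
    linear_combination e1 - e0
  have hd : t * (b + (b + t * (b * (z - x)))) =
      t * b * ((t * z + α + 1) - (t * x + α - 1)) := by ring
  rw [hd]
  have hsq : (t * b * ((t * z + α + 1) - (t * x + α - 1))) ^ 2 =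
      (t * b * ((t * x + α - 1) + (t * z + α + 1))) ^ 2 -
        4 * t ^ 2 * b * (b * (t * x + α - 1) * (t * z + α + 1)) := by ring
  rw [hsq, hprod, hsum]
  ring

end HankelOrtho

/-! ### Integrals of the weight: bounds, differentiation, recurrence, positivity -/

namespace PollaczekJacobi

open MeasureTheory Filter Topology Set Polynomial

/-- The exponential decay at `0` beats any power of `x`. Uniformity over `t ≥ t₀` supplies the
dominating constant for differentiation under the integral. -/
lemma exp_mul_rpow_le (s : ℝ) {t₀ : ℝ} (h₀ : 0 < t₀) :
    ∃ C, ∀ t, t₀ ≤ t → ∀ x ∈ Ioc (0 : ℝ) 1, Real.exp (-t / x) * x ^ s ≤ C := by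
  obtain ⟨N, hN⟩ := exists_nat_ge (-s)
  refine ⟨N.factorial / t₀ ^ N, fun t ht x hx => ?_⟩
  have hx0 := hx.1
  have h1 : Real.exp (-t / x) ≤ N.factorial / t₀ ^ N * x ^ (N : ℝ) := by
    have h2 := Real.pow_div_factorial_le_exp (t₀ / x) (by positivity) N
    have h3 : Real.exp (-t / x) ≤ (Real.exp (t₀ / x))⁻¹ := by
      rw [← Real.exp_neg, Real.exp_le_exp, ← neg_div]
      gcongr
    refine h3.trans ((inv_anti₀ (by positivity) h2).trans (le_of_eq ?_))
    rw [Real.rpow_natCast, div_pow]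
    field_simp
  calc Real.exp (-t / x) * x ^ s ≤ N.factorial / t₀ ^ N * x ^ (N : ℝ) * x ^ s := by gcongr
    _ = N.factorial / t₀ ^ N * x ^ (N + s) := by rw [mul_assoc, ← Real.rpow_add hx0]
    _ ≤ N.factorial / t₀ ^ N * 1 := by
      gcongr
      exact Real.rpow_le_one hx0.le hx.2 (by linarith)
    _ = _ := mul_one _

lemma weight_nonneg (s β t : ℝ) {x : ℝ} (hx : x ∈ Ioc (0 : ℝ) 1) : 0 ≤ weight s β t x :=
  mul_nonneg (mul_nonneg (Real.exp_pos _).le (Real.rpow_nonneg hx.1.le _))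
    (Real.rpow_nonneg (sub_nonneg.2 hx.2) _)

lemma weight_pos (s β t : ℝ) {x : ℝ} (hx : x ∈ Ioo (0 : ℝ) 1) : 0 < weight s β t x :=
  mul_pos (mul_pos (Real.exp_pos _) (Real.rpow_pos_of_pos hx.1 _))
    (Real.rpow_pos_of_pos (sub_pos.2 hx.2) _)

lemma weight_bounded (s : ℝ) {β t₀ : ℝ} (hβ : 0 ≤ β) (h₀ : 0 < t₀) :
    ∃ C, ∀ t, t₀ ≤ t → ∀ x ∈ Ioc (0 : ℝ) 1, weight s β t x ≤ C := by
  obtain ⟨C, hC⟩ := exp_mul_rpow_le s h₀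
  refine ⟨C, fun t ht x hx => le_trans ?_ (hC t ht x hx)⟩
  refine mul_le_of_le_one_right (mul_nonneg (Real.exp_pos _).le (Real.rpow_nonneg hx.1.le _)) ?_
  exact Real.rpow_le_one (sub_nonneg.2 hx.2) (by linarith [hx.1]) hβ

lemma measurable_weight (s β t : ℝ) : Measurable (weight s β t) := by
  unfold weight; fun_prop

lemma intervalIntegrable_weight (s : ℝ) {β t : ℝ} (hβ : 0 ≤ β) (ht : 0 < t) :
    IntervalIntegrable (weight s β t) volume 0 1 := by
  rw [intervalIntegrable_iff_integrableOn_Ioc_of_le zero_le_one]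
  obtain ⟨C, hC⟩ := weight_bounded s hβ ht
  refine Measure.integrableOn_of_bounded (M := C) measure_Ioc_lt_top.ne
    (measurable_weight s β t).aestronglyMeasurable ?_
  filter_upwards [ae_restrict_mem measurableSet_Ioc] with x hx
  rw [Real.norm_of_nonneg (weight_nonneg s β t hx)]
  exact hC t le_rfl x hx

/-- The moment of the weight with an arbitrary real exponent of `x`. -/
noncomputable def realMoment (β s t : ℝ) : ℝ := ∫ x in (0 : ℝ)..1, weight s β t x

lemma weight_sub_one (s β t : ℝ) {x : ℝ} (hx : 0 < x) :
    weight (s - 1) β t x = weight s β t x / x := by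
  rw [weight, weight, Real.rpow_sub_one hx.ne']; ring

lemma hasDerivAt_weight (s β t x : ℝ) :
    HasDerivAt (fun u => weight s β u x) (-(weight s β t x / x)) t := by
  have h := ((((hasDerivAt_id t).neg.div_const x).exp).mul_const (x ^ s)).mul_const ((1 - x) ^ β)
  refine h.congr_deriv ?_
  simp only [weight, id, Pi.neg_apply]; ring

lemma hasDerivAt_realMoment (s : ℝ) {β t : ℝ} (hβ : 0 ≤ β) (ht : 0 < t) :
    HasDerivAt (realMoment β s) (-realMoment β (s - 1) t) t := by
  obtain ⟨C, hC⟩ := weight_bounded (s - 1) hβ (half_pos ht)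
  have h := (intervalIntegral.hasDerivAt_integral_of_dominated_loc_of_deriv_le (μ := volume)
    (a := 0) (b := 1) (F := fun u x => weight s β u x) (F' := fun u x => -weight (s - 1) β u x)
    (x₀ := t) (bound := fun _ => C) (Ioi_mem_nhds (half_lt_self ht))
    (Eventually.of_forall fun u => (measurable_weight s β u).aestronglyMeasurable)
    (intervalIntegrable_weight s hβ ht)
    (measurable_weight (s - 1) β t).neg.aestronglyMeasurable
    (Eventually.of_forall fun x hx u hu => by
      rw [uIoc_of_le zero_le_one] at hx
      rw [norm_neg, Real.norm_of_nonneg (weight_nonneg _ β u hx)]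
      exact hC u (le_of_lt hu) x hx)
    intervalIntegrable_const
    (Eventually.of_forall fun x hx u _ => by
      rw [uIoc_of_le zero_le_one] at hx
      rw [weight_sub_one s β u hx.1]
      exact hasDerivAt_weight s β u x)).2
  rwa [intervalIntegral.integral_neg] at h

/-- The extra factor `1 - x` cancels the denominator that differentiating `(1-x)^β` would create,
leaving a combination of weights with the same `β`. -/
lemma hasDerivAt_weight_succ (r β t : ℝ) {x : ℝ} (hx : x ∈ Ioo (0 : ℝ) 1) :
    HasDerivAt (weight r (β + 1) t)
      (t * weight (r - 2) β t x - (t - r) * weight (r - 1) β t x - (r + β + 1) * weight r β t x)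
      x := by
  have hx0 := hx.1.ne'
  have hx1 : 1 - x ≠ 0 := (sub_pos.2 hx.2).ne'
  have h1 := ((hasDerivAt_const x (-t)).div (hasDerivAt_id x) hx0).exp
  have h2 := (hasDerivAt_id x).rpow_const (p := r) (Or.inl hx0)
  have h3 := ((hasDerivAt_const x (1 : ℝ)).sub (hasDerivAt_id x)).rpow_const (p := β + 1)
    (Or.inl hx1)
  refine ((h1.mul h2).mul h3).congr_deriv ?_
  have e2 : x ^ (r - 2) = x ^ r / x ^ 2 := by
    rw [Real.rpow_sub hx.1]; norm_num
  simp only [weight, id, Pi.div_apply, Pi.sub_apply, Pi.mul_apply, add_sub_cancel_right,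
    Real.rpow_sub_one hx0, Real.rpow_add_one hx1, e2]
  field_simp
  ring

/-- Integrate the derivative of the weight with exponent `β + 1` over `(0,1)`; both boundary terms
vanish. -/
lemma realMoment_recurrence (r : ℝ) {β t : ℝ} (hβ : 0 ≤ β) (ht : 0 < t) :
    t * realMoment β (r - 2) t =
      (t - r) * realMoment β (r - 1) t + (r + β + 1) * realMoment β r t := by
  have i2 := (intervalIntegrable_weight (r - 2) hβ ht).const_mul t
  have i1 := (intervalIntegrable_weight (r - 1) hβ ht).const_mul (t - r)
  have i0 := (intervalIntegrable_weight r hβ ht).const_mul (r + β + 1)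
  have hl : Tendsto (weight r (β + 1) t) (𝓝[>] 0) (𝓝 0) := by
    -- Bounding the weight with exponent `r - 1` gives the bound `C x` for exponent `r`, hence the
    -- limit `0`.
    obtain ⟨C, hC⟩ := weight_bounded (r - 1) (β := β + 1) (by linarith) ht
    have hlim : Tendsto (fun x : ℝ => C * x) (𝓝[>] 0) (𝓝 0) := by
      have : Tendsto (fun x : ℝ => C * x) (𝓝 0) (𝓝 (C * 0)) := tendsto_id.const_mul C
      rw [mul_zero] at this
      exact this.mono_left nhdsWithin_le_nhds
    refine tendsto_of_tendsto_of_tendsto_of_le_of_le' tendsto_const_nhds hlim ?_ ?_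
    · filter_upwards [Ioc_mem_nhdsGT (zero_lt_one (α := ℝ))] with x hx
      exact weight_nonneg _ _ _ hx
    · filter_upwards [Ioc_mem_nhdsGT (zero_lt_one (α := ℝ))] with x hx
      have := hC t le_rfl x hx
      rwa [weight_sub_one _ _ _ hx.1, div_le_iff₀ hx.1] at this
  have hr : Tendsto (weight r (β + 1) t) (𝓝[<] 1) (𝓝 0) := by
    have hc : ContinuousAt (weight r (β + 1) t) 1 := by
      refine ((ContinuousAt.rexp (continuousAt_const.div continuousAt_id one_ne_zero)).mul
        (continuousAt_id.rpow_const (Or.inl one_ne_zero))).mul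
        ((continuousAt_const.sub continuousAt_id).rpow_const (Or.inr (by linarith)))
    have h1 : weight r (β + 1) t 1 = 0 := by
      rw [weight, sub_self, Real.zero_rpow (by linarith), mul_zero]
    have := hc.tendsto
    rw [h1] at this
    exact this.mono_left nhdsWithin_le_nhds
  have h := intervalIntegral.integral_eq_sub_of_hasDerivAt_of_tendsto zero_lt_one
    (fun x hx => hasDerivAt_weight_succ r β t hx) ((i2.sub i1).sub i0) hl hr
  rw [intervalIntegral.integral_sub (i2.sub i1) i0, intervalIntegral.integral_sub i2 i1,
    intervalIntegral.integral_const_mul, intervalIntegral.integral_const_mul,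
    intervalIntegral.integral_const_mul] at h
  simp only [realMoment]
  linarith

lemma weight_sub_natCast (s β t : ℝ) (k : ℕ) {x : ℝ} (hx : 0 < x) :
    weight (s - k) β t x = x⁻¹ ^ k * weight s β t x := by
  rw [weight, weight, Real.rpow_sub_natCast hx.ne', inv_pow]; ring

lemma weight_add_natCast (s β t : ℝ) (k : ℕ) {x : ℝ} (hx : 0 < x) :
    weight (s + k) β t x = x ^ k * weight s β t x := by
  rw [weight, weight, Real.rpow_add_natCast hx.ne']; ring

lemma momentFunctional_realMoment (S : ℝ) {β t : ℝ} (hβ : 0 ≤ β) (ht : 0 < t) (q : ℝ[X]) :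
    IntervalIntegrable (fun x => q.eval x⁻¹ * weight S β t x) volume 0 1 ∧
    HankelOrtho.momentFunctional (fun k => realMoment β (S - k) t) q =
      ∫ x in (0 : ℝ)..1, q.eval x⁻¹ * weight S β t x := by
  have hi : ∀ i ∈ Finset.range (q.natDegree + 1),
      IntervalIntegrable (fun x => q.coeff i * weight (S - (i : ℕ)) β t x) volume 0 1 :=
    fun i _ => (intervalIntegrable_weight _ hβ ht).const_mul _
  have e : ∀ x ∈ uIoc (0 : ℝ) 1,
      (∑ i ∈ Finset.range (q.natDegree + 1), fun x => q.coeff i * weight (S - (i : ℕ)) β t x) x =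
        q.eval x⁻¹ * weight S β t x := by
    intro x hx
    rw [uIoc_of_le zero_le_one] at hx
    rw [Finset.sum_apply, eval_eq_sum_range, Finset.sum_mul]
    exact Finset.sum_congr rfl fun i _ => by rw [weight_sub_natCast _ _ _ _ hx.1]; ring
  have hI := IntervalIntegrable.sum _ hi
  refine ⟨hI.congr fun x hx => e x hx, ?_⟩
  rw [HankelOrtho.momentFunctional_eq_sum _ q (Nat.lt_succ_self _),
    ← intervalIntegral.integral_congr_ae (Eventually.of_forall e)]
  simp only [Finset.sum_apply]
  rw [intervalIntegral.integral_finsetSum hi]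
  simp only [intervalIntegral.integral_const_mul, realMoment]

/-- The integrand `q(1/x)² w` is nonnegative and, on `(0,1)`, vanishes only at reciprocals of roots
of `q`, a finite set. -/
lemma posFunctional_realMoment (S : ℝ) {β t : ℝ} (hβ : 0 ≤ β) (ht : 0 < t) :
    HankelOrtho.PosFunctional (fun k => realMoment β (S - k) t) := by
  intro q hq
  obtain ⟨hi, he⟩ := momentFunctional_realMoment S hβ ht (q * q)
  rw [he, intervalIntegral.integral_pos_iff_support_of_nonneg_ae' _ hi]
  · refine ⟨zero_lt_one, ?_⟩
    have hfin : ((fun x : ℝ => x⁻¹) '' {y | q.IsRoot y}).Finite := (finite_setOfPred_isRoot hq).image _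
    have hsub : Ioo (0 : ℝ) 1 \ ((fun x : ℝ => x⁻¹) '' {y | q.IsRoot y}) ⊆
        Function.support (fun x => (q * q).eval x⁻¹ * weight S β t x) ∩ Ioc 0 1 := by
      rintro x ⟨hx, hxr⟩
      refine ⟨mul_ne_zero ?_ (weight_pos S β t hx).ne', Ioo_subset_Ioc_self hx⟩
      have : q.eval x⁻¹ ≠ 0 := fun h => hxr ⟨x⁻¹, h, inv_inv x⟩
      rw [eval_mul]
      exact mul_ne_zero this this
    refine lt_of_lt_of_le ?_ (measure_mono hsub)
    rw [measure_sdiff_null (hfin.measure_zero volume), Real.volume_Ioo]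
    simp
  · rw [uIoc_of_le zero_le_one]
    filter_upwards [ae_restrict_mem measurableSet_Ioc] with x hx
    rw [eval_mul]
    exact mul_nonneg (mul_self_nonneg _) (weight_nonneg S β t hx)

lemma expMoments_realMoment (S : ℝ) {β : ℝ} (hβ : 0 ≤ β) :
    HankelOrtho.ExpMoments (fun t k => realMoment β (S - k) t) where
  pos _ ht := posFunctional_realMoment S hβ ht
  hasDerivAt t ht k := by
    have h := hasDerivAt_realMoment (S - k) hβ ht
    rwa [show S - k - 1 = S - (k + 1 : ℕ) by push_cast; ring] at h

lemma pearsonMoments_realMoment (S : ℝ) {β t : ℝ} (hβ : 0 ≤ β) (ht : 0 < t) :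
    HankelOrtho.PearsonMoments t S β (fun k => realMoment β (S - k) t) := by
  intro k
  have h := realMoment_recurrence (S - k) hβ ht
  simp only [Nat.cast_add, Nat.cast_ofNat, Nat.cast_one, ← sub_sub]
  rw [h]; ring

/-! ### Transfer to `D_n` and comparison with Painlevé V -/

lemma moment_eq_realMoment (α β : ℝ) (k : ℕ) (t : ℝ) :
    moment α β k t = realMoment β (α + k) t := by
  refine intervalIntegral.integral_congr_ae (Eventually.of_forall fun x hx => ?_)
  rw [uIoc_of_le zero_le_one] at hx
  exact (weight_add_natCast α β t k hx.1).symm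

/-- Replacing `i, j` by `n - i, n - j` leaves the determinant unchanged and turns the exponent `α +
i + j` into `α + 2n - (i + j)`, which is where `S = α + 2n` comes from. -/
lemma hankelDet_succ_eq (α β : ℝ) (n : ℕ) (t : ℝ) :
    hankelDet α β (n + 1) t = (Matrix.of fun i j : Fin (n + 1) =>
      realMoment β (α + 2 * n - ((i : ℕ) + (j : ℕ) : ℕ)) t).det := by
  rw [hankelDet, ← Matrix.det_submatrix_equiv_self Fin.revPerm]
  congr 1
  ext i j
  simp only [Matrix.submatrix_apply, Matrix.of_apply, Fin.revPerm_apply, Fin.val_rev,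
    moment_eq_realMoment]
  congr 1
  have hi : (i : ℕ) ≤ n := by omega
  have hj : (j : ℕ) ≤ n := by omega
  rw [Nat.add_sub_add_right, Nat.add_sub_add_right]
  push_cast [hi, hj]
  ring

lemma hankelDet_zero (α β t : ℝ) : hankelDet α β 0 t = 1 := by simp [hankelDet]

lemma intervalIntegrable_pow_mul_weight (α : ℝ) {β t : ℝ} (hβ : 0 ≤ β) (ht : 0 < t) (k : ℕ) :
    IntervalIntegrable (fun x : ℝ => x ^ k * weight α β t x) volume 0 1 :=
  (intervalIntegrable_weight (α + k) hβ ht).congr fun x hx => by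
    rw [uIoc_of_le zero_le_one] at hx
    exact weight_add_natCast α β t k hx.1

lemma hankelDet_pos (α : ℝ) {β t : ℝ} (hβ : 0 ≤ β) (ht : 0 < t) (n : ℕ) :
    0 < hankelDet α β n t := by
  cases n with
  | zero => rw [hankelDet_zero]; exact one_pos
  | succ n =>
    rw [hankelDet_succ_eq]
    exact (expMoments_realMoment (α + 2 * n) hβ).hankel_pos ht (n + 1)

lemma differentiableAt_hankelDet (α : ℝ) {β t : ℝ} (hβ : 0 ≤ β) (ht : 0 < t) (n : ℕ) :
    DifferentiableAt ℝ (hankelDet α β n) t := by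
  cases n with
  | zero =>
    rw [show hankelDet α β 0 = fun _ => 1 from funext (hankelDet_zero α β)]
    exact differentiableAt_const _
  | succ n =>
    rw [show hankelDet α β (n + 1) = _ from funext (hankelDet_succ_eq α β n)]
    exact (expMoments_realMoment (α + 2 * n) hβ).differentiableAt_hankel ht (n + 1)

lemma solvesHankelODE_logDerivHankel (α : ℝ) {β : ℝ} (hβ : 0 ≤ β) (n : ℕ) :
    SolvesHankelODE α β n (logDerivHankel α β n) := by
  cases n with
  | zero =>
    have h : logDerivHankel α β 0 = fun _ => 0 := by
      funext t; simp [logDerivHankel, hankelDet_zero]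
    rw [h]
    refine ⟨fun t _ => ?_, fun t _ => ?_⟩ <;> simp
  | succ n =>
    have hm := expMoments_realMoment (α + 2 * n) hβ
    have hH : ∀ t, 0 < t → logDerivHankel α β (n + 1) t = t * HankelOrtho.subCoeff
        (fun k => realMoment β (α + 2 * n - k) t) (n + 1) := by
      intro t ht
      simp only [logDerivHankel, hankelDet_succ_eq]
      rw [(hm.hasDerivAt_log_hankel ht (n + 1)).deriv]
    have h := fun t ht => hm.sigma_form
      (fun t ht => pearsonMoments_realMoment (α + 2 * n) hβ ht) hH (t := t) ht
    refine ⟨fun t ht => ⟨(h t ht).1, (h t ht).2.1⟩, fun t ht => ?_⟩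
    push_cast
    exact (h t ht).2.2

lemma solvesHankelODE_iff_solvesSigmaPV (α β : ℝ) (n : ℕ) (H : ℝ → ℝ) :
    SolvesHankelODE α β n H ↔ SolvesSigmaPV 0 (-((n : ℝ) + α + β)) n (-β)
      (fun t => H t - (n : ℝ) * ((n : ℝ) + α + β)) := by
  have hd : deriv (fun t => H t - (n : ℝ) * ((n : ℝ) + α + β)) = deriv H :=
    funext fun t => deriv_sub_const _
  have hdiff : ∀ t, DifferentiableAt ℝ (fun t => H t - (n : ℝ) * ((n : ℝ) + α + β)) t ↔
      DifferentiableAt ℝ H t := fun t =>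
    ⟨fun h => by simpa using h.add_const ((n : ℝ) * ((n : ℝ) + α + β)), fun h => h.sub_const _⟩
  unfold SolvesHankelODE SolvesSigmaPV TwiceDifferentiable
  simp only [hd, hdiff]
  refine and_congr_right fun _ => forall₂_congr fun t _ => ?_
  -- The shift changes no derivative, so the left sides agree; for these parameters the right sides
  -- are the same polynomial in `t`, `H`, `H'`.
  refine Eq.congr_right ?_
  ring

end PollaczekJacobi

theorem mainTheorem1 (α β : ℝ) (hα : 0 < α) (hβ : 0 < β) (n : ℕ) :
    -- the moments converge, `D_n > 0`, and `D_n` is differentiable on `(0,∞)`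
    (∀ t : ℝ, 0 < t →
      (∀ k : ℕ, IntervalIntegrable (fun x : ℝ => x ^ k * PollaczekJacobi.weight α β t x)
        MeasureTheory.volume 0 1) ∧
      0 < PollaczekJacobi.hankelDet α β n t ∧
      DifferentiableAt ℝ (PollaczekJacobi.hankelDet α β n) t) ∧
    -- the differential equation for `H_n`
    PollaczekJacobi.SolvesHankelODE α β n (PollaczekJacobi.logDerivHankel α β n) ∧
    -- under the shift by `n(n+α+β)` this equation is the σ-form of Painlevé V
    (∀ H : ℝ → ℝ, PollaczekJacobi.SolvesHankelODE α β n H ↔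
      PollaczekJacobi.SolvesSigmaPV 0 (-((n : ℝ) + α + β)) n (-β)
        (fun t => H t - (n : ℝ) * ((n : ℝ) + α + β))) ∧
    -- in particular the shifted `H_n` solves the σ-form
    PollaczekJacobi.SolvesSigmaPV 0 (-((n : ℝ) + α + β)) n (-β)
      (fun t => PollaczekJacobi.logDerivHankel α β n t - (n : ℝ) * ((n : ℝ) + α + β)) :=
  ⟨fun _ ht => ⟨PollaczekJacobi.intervalIntegrable_pow_mul_weight α hβ.le ht,
      PollaczekJacobi.hankelDet_pos α hβ.le ht n,
      PollaczekJacobi.differentiableAt_hankelDet α hβ.le ht n⟩,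
    PollaczekJacobi.solvesHankelODE_logDerivHankel α hβ.le n,
    PollaczekJacobi.solvesHankelODE_iff_solvesSigmaPV α β n,
    (PollaczekJacobi.solvesHankelODE_iff_solvesSigmaPV α β n _).1
      (PollaczekJacobi.solvesHankelODE_logDerivHankel α hβ.le n)⟩
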